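/- Let $\eta(\tau)=q^{1/24}\prod_{n\ge 1}(1-q^n)$, $q=e^{2\pi i\tau}$, be the Dedekind eta function on the upper half plane $\mathbb H$, and define there the string functions $$c_0=\tfrac12\Big(\frac{\eta(\tau/2)}{\eta(\tau)^2}+\frac{\eta(\tau)}{\eta(2\tau)\eta(\tau/2)}\Big)=q^{-1/16}(1+q+\cdots),\quad c_1=\tfrac12\Big(\frac{\eta(\tau)}{\eta(2\tau)\eta(\tau/2)}-\frac{\eta(\tau/2)}{\eta(\tau)^2}\Big)=q^{-1/16}(q^{1/2}+2q^{3/2}+\cdots),\quad c_2=\frac{\eta(2\tau)}{\eta(\tau)^2},$$ and the functions $$h(\tau)=\eta(\tau)^{-8}\eta(2\tau)^{-8},\qquad g_0(\tau)=\tfrac12\big(h(\tfrac{\tau}{2})+h(\tfrac{\tau+1}{2})\big),\qquad g_1(\tau)=\tfrac12\big(h(\tfrac{\tau}{2})-h(\tfrac{\tau+1}{2})\big).$$ For a set $C$ of binary words of length $n$ let $W_C(x,y)=\sum_{c\in C}x^{n-\mathrm{wt}(c)}y^{\mathrm{wt}(c)}$ be its Hamming weight enumerator. Let $\mathcal H_{16}\subset\mathbf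 F_2^{16}$ be the Hamming code of length $16$, i.e. the dual of the first order Reed–Muller code spanned by $1^{16}$, $1^80^8$, $(1^40^4)^2$, $(1^20^2)^4$ and $(10)^8$, and let $(\mathbf F_2^8)_0$ and $(\mathbf F_2^8)_1$ be the sets of vectors of even and of odd weight in $\mathbf F_2^8$. Then, on $\mathbb H$, $$g_0+h=W_{\mathcal H_{16}}(c_0,c_1),$$ $$g_0=W_{\mathcal H_{16}+(1,1,0,\ldots,0)}(c_0,c_1)=W_{(\mathbf F_2^8)_1}(c_0,c_1)\cdot c_2^8=2^3c_2^{16},$$ $$g_1=W_{\mathcal H_{16}+(1,0,0,\ldots,0)}(c_0,c_1)=W_{(\mathbf F_2^8)_0}(c_0,c_1)\cdot c_2^8.$$ All of these functions are modular functions of weight $-8$ for $\widetilde\Gamma(16)$, the inverse image of $\Gamma(16)$ in the metaplectic group $\mathrm{Mp}_2(\mathbf Z)$ of pairs $(\gamma,\varphi)$ with $\gamma=\begin{pmatrix}a&b\\c&d\end{pmatrix}\in\mathrm{SL}_2(\mathbf Z)$ and $\varphi$ holomorphic on $\mathbb H$ with $\varphi(\tau)^2=c\tau+d$: they are holomorphic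 on $\mathbb H$, satisfy $f(\gamma\tau)=\varphi(\tau)^{-16}f(\tau)$ for all $(\gamma,\varphi)\in\widetilde\Gamma(16)$, and are meromorphic at all cusps. -/

import Mathlib

open UpperHalfPlane ModularForm MatrixGroups
open scoped Manifold

noncomputable section

namespace FakeBabyMonster

/-! ### Binary codes and Hamming weight enumerators -/

/-- The five generators of the first order Reed-Muller code of length `16`. -/
def reedMullerRows : Fin 5 → Fin 16 → ZMod 2 :=
  ![![1, 1, 1, 1, 1, 1, 1, 1, 1, 1, 1, 1, 1, 1, 1, 1],
    ![1, 1, 1, 1, 1, 1, 1, 1, 0, 0, 0, 0, 0, 0, 0, 0],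
    ![1, 1, 1, 1, 0, 0, 0, 0, 1, 1, 1, 1, 0, 0, 0, 0],
    ![1, 1, 0, 0, 1, 1, 0, 0, 1, 1, 0, 0, 1, 1, 0, 0],
    ![1, 0, 1, 0, 1, 0, 1, 0, 1, 0, 1, 0, 1, 0, 1, 0]]

/-- The first order Reed-Muller code of length `16`. -/
def reedMuller16 : Submodule (ZMod 2) (Fin 16 → ZMod 2) :=
  Submodule.span (ZMod 2) (Set.range reedMullerRows)

/-- The Hamming code of length `16`: the dual of the Reed-Muller code `reedMuller16`. -/
def hamming16 : Submodule (ZMod 2) (Fin 16 → ZMod 2) where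
  carrier := {c | ∀ d ∈ reedMuller16, ∑ i, c i * d i = 0}
  zero_mem' := by intro d _; simp
  add_mem' := by
    intro a b ha hb d hd
    simp only [Pi.add_apply, add_mul, Finset.sum_add_distrib]
    rw [ha d hd, hb d hd, add_zero]
  smul_mem' := by
    intro r a ha d hd
    simp only [Pi.smul_apply, smul_eq_mul, mul_assoc, ← Finset.mul_sum]
    rw [ha d hd, mul_zero]

/-- The coset `H₁₆ + d` of the Hamming code. -/
def hammingCoset (d : Fin 16 → ZMod 2) : Set (Fin 16 → ZMod 2) :=
  {v | ∃ c ∈ hamming16, v = c + d}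

/-- The vector `(1, 1, 0, …, 0)` of length `16`. -/
def vec11 : Fin 16 → ZMod 2 := ![1, 1, 0, 0, 0, 0, 0, 0, 0, 0, 0, 0, 0, 0, 0, 0]

/-- The vector `(1, 0, …, 0)` of length `16`. -/
def vec1 : Fin 16 → ZMod 2 := ![1, 0, 0, 0, 0, 0, 0, 0, 0, 0, 0, 0, 0, 0, 0, 0]

/-- The vectors of even weight in `F₂⁸`. -/
def evenWords8 : Set (Fin 8 → ZMod 2) := {v | Even (hammingNorm v)}

/-- The vectors of odd weight in `F₂⁸`. -/
def oddWords8 : Set (Fin 8 → ZMod 2) := {v | Odd (hammingNorm v)}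

open Classical in
/-- The Hamming weight enumerator `W_C(x, y) = ∑_{c ∈ C} x ^ (n - wt c) * y ^ wt c` of a set `C`
of binary words of length `n` (`hammingNorm` is the number of nonzero coordinates). -/
def weightEnumerator {n : ℕ} (C : Set (Fin n → ZMod 2)) (x y : ℂ) : ℂ :=
  ∑ c : Fin n → ZMod 2 with c ∈ C, x ^ (n - hammingNorm c) * y ^ hammingNorm c

/-! ### String functions and the functions `h`, `g₀`, `g₁`

Here `η` is the Dedekind eta function; all functions are considered on the upper half plane. -/

/-- The string function
`c₀ = (η(τ/2)/η(τ)² + η(τ)/(η(2τ)η(τ/2)))/2 = q^(-1/16) (1 + q + 3q² + ⋯)`. -/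
def c₀ (τ : ℂ) : ℂ := (η (τ / 2) / η τ ^ 2 + η τ / (η (2 * τ) * η (τ / 2))) / 2

/-- The string function
`c₁ = (η(τ)/(η(2τ)η(τ/2)) - η(τ/2)/η(τ)²)/2 = q^(-1/16) (q^(1/2) + 2q^(3/2) + ⋯)`. -/
def c₁ (τ : ℂ) : ℂ := (η τ / (η (2 * τ) * η (τ / 2)) - η (τ / 2) / η τ ^ 2) / 2

/-- The string function `c₂ = η(2τ)/η(τ)² = 1 + 2q + 4q² + ⋯`. -/
def c₂ (τ : ℂ) : ℂ := η (2 * τ) / η τ ^ 2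

/-- `h(τ) = η(τ)⁻⁸ η(2τ)⁻⁸`. -/
def h (τ : ℂ) : ℂ := (η τ ^ 8)⁻¹ * (η (2 * τ) ^ 8)⁻¹

/-- `g₀(τ) = (h(τ/2) + h((τ+1)/2))/2`. -/
def g₀ (τ : ℂ) : ℂ := (h (τ / 2) + h ((τ + 1) / 2)) / 2

/-- `g₁(τ) = (h(τ/2) - h((τ+1)/2))/2`. -/
def g₁ (τ : ℂ) : ℂ := (h (τ / 2) - h ((τ + 1) / 2)) / 2

/-! ### Modular functions for `Γ̃(N)` -/

/-- The elements of the metaplectic group `Mp₂(ℤ)`: pairs `(γ, φ)` of a matrix `γ ∈ SL₂(ℤ)` with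
lower row `(c, d)` and a holomorphic function `φ` on the upper half plane with
`φ(τ)² = cτ + d`. -/
structure Mp2Z where
  /-- the underlying matrix -/
  mat : SL(2, ℤ)
  /-- the chosen square root of `cτ + d` -/
  root : ℍ → ℂ
  holo : MDiff root
  root_sq : ∀ τ : ℍ, root τ ^ 2 = (mat 1 0 : ℂ) * (τ : ℂ) + (mat 1 1 : ℂ)

/-- `Γ̃(N)`, the inverse image in `Mp₂(ℤ)` of the principal congruence subgroup `Γ(N)`. -/
def gammaTilde (N : ℕ) : Set Mp2Z := {γ | γ.mat ∈ CongruenceSubgroup.Gamma N}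

/-- The weight `k` action of `(γ, φ)`: `(f|ₖ(γ, φ))(τ) = φ(τ)^(-2k) f(γτ)`. -/
def mpSlash (k : ℤ) (f : ℍ → ℂ) (γ : Mp2Z) (τ : ℍ) : ℂ :=
  γ.root τ ^ (-2 * k) * f (γ.mat • τ)

/-- Modular functions of (integral) weight `k` for `Γ̃(N)` with poles at most at the cusps:
holomorphic functions on the upper half plane, invariant under `Γ̃(N)` in weight `k`, and
meromorphic at every cusp, i.e. every translate `f|ₖγ`, `γ ∈ Mp₂(ℤ)`, is `O(|q|^(-n))` for some
`n` as `Im τ → ∞`, where `q = e^(2πiτ)`. -/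
structure IsModularFunction (N : ℕ) (k : ℤ) (f : ℍ → ℂ) : Prop where
  holo : MDiff f
  invariant : ∀ γ ∈ gammaTilde N, mpSlash k f γ = f
  mero_cusps : ∀ γ : Mp2Z, ∃ n : ℕ,
    IsBoundedAtImInfty fun τ : ℍ => Function.Periodic.qParam 1 (τ : ℂ) ^ n * mpSlash k f γ τ

end FakeBabyMonster

end

/-!
Write `A = η(τ/2)`, `B = η(τ)`, `C = η(2τ)`, `E = η((τ+1)/2)` and put `a = c₀ + c₁ = B/(AC)`,
`b = c₀ - c₁ = A/B²`.

The MacWilliams identity `weightEnumerator_syndromeClass` expresses the weight enumerators at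
`(c₀, c₁)` as polynomials in `a` and `b`. As the Reed-Muller code has weights `0`, `8` and `16`, the
code `H₁₆` and its two cosets give `(a¹⁶ + 30 a⁸b⁸ + b¹⁶)/32`, `(a⁸ - b⁸)²/32` and `(a¹⁶ - b¹⁶)/32`;
the odd and the even words of length `8` give `(a⁸ ∓ b⁸)/2`. On the other side the product formula
`E A C = e^(πi/24) B³` (`eta_add_one_half_mul`) turns `h((τ+1)/2)` into `-A⁸C⁸/B³²`, so that
`g₀ = (a⁸ - b⁸)/2 · c₂⁸`, `g₁ = (a⁸ + b⁸)/2 · c₂⁸` and `h = a⁸b⁸`. All identities then follow from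
`a⁸ - b⁸ = 16 c₂⁸`, which is Jacobi's identity (`eta_jacobi_identity`).

Jacobi's identity amounts to the vanishing of `R = A⁸ + 16 C⁸ + e^(2πi/3) E⁸`. The transformation
laws of `η` give `R(τ+1) = e^(4πi/3) R(τ)` and `R(-1/τ) = τ⁴ R(τ)`, so `R³` is a cusp form of weight
`12` and level one, hence a multiple of the discriminant. The two laws at `τ = e^(2πi/3)`, where
`-1/τ = τ + 1`, force `R` to vanish there, whereas the discriminant does not (`jacobiForm_eq_zero`).

For the modularity, `h/16`, `h(τ/2)` and `h((τ+1)/2)` are permuted in weight `-8` by `SL₂(ℤ)` in the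
same way as the three nonzero row vectors modulo `2` (`hTranslate_slash`). They are therefore
invariant under `Γ(2) ⊇ Γ(16)`, and each of them has at most a simple pole in `q` at every cusp.
-/

/-! ### Weight enumerators of binary codes given by parity checks -/

namespace FakeBabyMonster

/-- The nontrivial character `±1` of `ZMod 2`, with complex values. -/
noncomputable def signChar : AddChar (ZMod 2) ℂ := AddChar.zmodChar 2 (ζ := -1) (by norm_num)

lemma signChar_zero : signChar 0 = 1 := AddChar.map_zero_eq_one _

lemma signChar_one : signChar 1 = -1 := by
  simp [signChar, AddChar.zmodChar_apply, ZMod.val_one]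

lemma signChar_sum {ι : Type*} (s : Finset ι) (f : ι → ZMod 2) :
    signChar (∑ i ∈ s, f i) = ∏ i ∈ s, signChar (f i) := by
  classical
  induction s using Finset.induction_on with
  | empty => simp
  | insert i s hi ih =>
    rw [Finset.sum_insert hi, Finset.prod_insert hi, AddChar.map_add_eq_mul, ih]

lemma forall_zmod_two {p : ZMod 2 → Prop} (h0 : p 0) (h1 : p 1) (t : ZMod 2) : p t := by
  fin_cases t
  exacts [h0, h1]

lemma sum_zmod_two (f : ZMod 2 → ℂ) : ∑ t, f t = f 0 + f 1 := Fin.sum_univ_two f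

lemma sum_signChar_mul (t : ZMod 2) : ∑ m, signChar (m * t) = if t = 0 then 2 else 0 := by
  rw [sum_zmod_two]
  induction t using forall_zmod_two <;> norm_num [signChar_zero, signChar_one]

lemma half_sum_signChar_mul (t : ZMod 2) :
    (2 : ℂ)⁻¹ * ∑ m, signChar (m * t) = if t = 0 then 1 else 0 := by
  rw [sum_signChar_mul]
  split_ifs <;> norm_num

lemma sum_mul_signChar_mul (x y : ℂ) (d : ZMod 2) :
    ∑ e : ZMod 2, (if e = 0 then x else y) * signChar (e * d) =
      if d = 0 then x + y else x - y := by
  rw [sum_zmod_two]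
  induction d using forall_zmod_two <;> simp [signChar_one, sub_eq_add_neg]

lemma prod_ite_eq_pow_hammingNorm {n : ℕ} (x y : ℂ) (c : Fin n → ZMod 2) :
    ∏ i, (if c i = 0 then x else y) = x ^ (n - hammingNorm c) * y ^ hammingNorm c := by
  rw [Finset.prod_ite, Finset.prod_const, Finset.prod_const]
  have hcard := Finset.card_filter_add_card_filter_not
    (s := (Finset.univ : Finset (Fin n))) (fun i => c i = 0)
  rw [Finset.card_univ, Fintype.card_fin] at hcard
  have hnorm : hammingNorm c = (Finset.univ.filter fun i => ¬ c i = 0).card := rfl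
  rw [hnorm]
  congr 2
  omega

/-- The set of words with prescribed syndrome `s` with respect to the parity checks `G`. -/
def syndromeClass {n k : ℕ} (G : Fin k → Fin n → ZMod 2) (s : Fin k → ZMod 2) :
    Set (Fin n → ZMod 2) :=
  {c | ∀ j, ∑ i, c i * G j i = s j}

/-- The code word `∑ j, m j • G j` of the code spanned by the rows of `G`. -/
def encode {n k : ℕ} (G : Fin k → Fin n → ZMod 2) (m : Fin k → ZMod 2) : Fin n → ZMod 2 :=
  fun i => ∑ j, m j * G j i

/-- The MacWilliams identity for a coset of the dual of the code spanned by the rows of `G`. The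
sum runs over messages `m`, so that no linear independence of the rows is needed. -/
theorem weightEnumerator_syndromeClass {n k : ℕ} (G : Fin k → Fin n → ZMod 2)
    (s : Fin k → ZMod 2) (x y : ℂ) :
    weightEnumerator (syndromeClass G s) x y =
      (2 ^ k)⁻¹ * ∑ m : Fin k → ZMod 2, signChar (∑ j, m j * s j) *
        ((x + y) ^ (n - hammingNorm (encode G m)) * (x - y) ^ hammingNorm (encode G m)) := by
  classical
  -- the indicator function of the syndrome class as a product of character sums, one per check
  have hind : ∀ c : Fin n → ZMod 2, (if c ∈ syndromeClass G s then (1 : ℂ) else 0) =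
      (2 ^ k)⁻¹ * ∑ m : Fin k → ZMod 2,
        signChar (∑ j, m j * s j) * ∏ i, signChar (c i * encode G m i) := by
    intro c
    have hprod : (if c ∈ syndromeClass G s then (1 : ℂ) else 0) =
        ∏ j, ((2 : ℂ)⁻¹ * ∑ m, signChar (m * (∑ i, c i * G j i + s j))) := by
      simp_rw [half_sum_signChar_mul, Finset.prod_ite_zero, Finset.prod_const_one]
      congr 1
      simp only [syndromeClass, Set.mem_ofPred_eq, Finset.mem_univ, true_imp_iff,
        ← CharTwo.sub_eq_add, sub_eq_zero]
    rw [hprod, Finset.prod_mul_distrib, Finset.prod_const, Finset.card_univ, Fintype.card_fin,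
      inv_pow, Finset.prod_univ_sum, Fintype.piFinset_univ]
    congr 1
    refine Finset.sum_congr rfl fun m _ => ?_
    rw [← signChar_sum, ← signChar_sum, ← AddChar.map_add_eq_mul]
    congr 1
    simp only [mul_add, Finset.sum_add_distrib, encode, Finset.mul_sum]
    rw [add_comm, Finset.sum_comm]
    congr 1
    exact Finset.sum_congr rfl fun i _ => Finset.sum_congr rfl fun j _ => by ring
  rw [weightEnumerator, Finset.sum_filter]
  calc _ = ∑ c : Fin n → ZMod 2, (if c ∈ syndromeClass G s then (1 : ℂ) else 0) *
        ∏ i, (if c i = 0 then x else y) := by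
        refine Finset.sum_congr rfl fun c _ => ?_
        rw [prod_ite_eq_pow_hammingNorm]
        split_ifs <;> simp
    _ = (2 ^ k)⁻¹ * ∑ m : Fin k → ZMod 2, signChar (∑ j, m j * s j) *
        ∑ c : Fin n → ZMod 2, ∏ i, ((if c i = 0 then x else y) *
          signChar (c i * encode G m i)) := by
        simp_rw [hind, mul_assoc, Finset.sum_mul, ← Finset.mul_sum]
        congr 1
        rw [Finset.sum_comm]
        refine Finset.sum_congr rfl fun m _ => ?_
        rw [Finset.mul_sum]
        refine Finset.sum_congr rfl fun c _ => ?_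
        rw [Finset.prod_mul_distrib]
        ring
    _ = _ := by
        congr 1
        refine Finset.sum_congr rfl fun m _ => ?_
        rw [← prod_ite_eq_pow_hammingNorm]
        simp_rw [← sum_mul_signChar_mul]
        rw [Finset.prod_univ_sum, Fintype.piFinset_univ]

lemma mem_hamming16_iff (c : Fin 16 → ZMod 2) :
    c ∈ hamming16 ↔ ∀ j, ∑ i, c i * reedMullerRows j i = 0 := by
  constructor
  · exact fun hc j => hc _ (Submodule.subset_span ⟨j, rfl⟩)
  · intro hc d hd
    induction hd using Submodule.span_induction with
    | mem x hx =>
      obtain ⟨j, rfl⟩ := hx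
      exact hc j
    | zero => simp
    | add x y _ _ hx hy => simp [mul_add, Finset.sum_add_distrib, hx, hy]
    | smul a x _ hx =>
      simp only [Pi.smul_apply, smul_eq_mul, mul_left_comm _ a, ← Finset.mul_sum, hx, mul_zero]

lemma hammingCoset_eq_syndromeClass (d : Fin 16 → ZMod 2) :
    hammingCoset d = syndromeClass reedMullerRows fun j => ∑ i, d i * reedMullerRows j i := by
  ext v
  simp only [hammingCoset, syndromeClass, Set.mem_ofPred_eq]
  constructor
  · rintro ⟨c, hc, rfl⟩ j
    simp [add_mul, Finset.sum_add_distrib, (mem_hamming16_iff c).1 hc j]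
  · refine fun hv => ⟨v - d, (mem_hamming16_iff _).2 fun j => ?_, by simp⟩
    simp [sub_mul, Finset.sum_sub_distrib, hv j]

/-- The first order Reed-Muller code has weights `0` and `16`, once each, and `8`. -/
lemma hammingNorm_encode_reedMullerRows : ∀ m : Fin 5 → ZMod 2,
    hammingNorm (encode reedMullerRows m) =
      if m = 0 then 0 else if m = ![1, 0, 0, 0, 0] then 16 else 8 := by
  decide +kernel

/-- The weight enumerator of a coset of the Hamming code, where `s` is the syndrome of the coset;
its three terms come from the words of weight `0`, `16` and `8` of the Reed-Muller code. -/
lemma weightEnumerator_syndromeClass_reedMullerRows (s : Fin 5 → ZMod 2) (x y : ℂ) :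
    weightEnumerator (syndromeClass reedMullerRows s) x y =
      ((x + y) ^ 16 + signChar (s 0) * (x - y) ^ 16 +
        (∑ m : Fin 5 → ZMod 2, signChar (∑ j, m j * s j) - 1 - signChar (s 0)) *
          ((x + y) ^ 8 * (x - y) ^ 8)) / 32 := by
  have hsplit : ∀ m : Fin 5 → ZMod 2,
      signChar (∑ j, m j * s j) * ((x + y) ^ (16 - hammingNorm (encode reedMullerRows m)) *
        (x - y) ^ hammingNorm (encode reedMullerRows m)) =
      signChar (∑ j, m j * s j) * ((x + y) ^ 8 * (x - y) ^ 8) +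
      (if m = 0 then (x + y) ^ 16 - (x + y) ^ 8 * (x - y) ^ 8 else 0) +
      (if m = ![1, 0, 0, 0, 0] then
        signChar (s 0) * ((x - y) ^ 16 - (x + y) ^ 8 * (x - y) ^ 8) else 0) := by
    intro m
    rw [hammingNorm_encode_reedMullerRows]
    by_cases h0 : m = 0
    · have h1 : (0 : Fin 5 → ZMod 2) ≠ ![1, 0, 0, 0, 0] := by decide
      subst h0
      simp [h1]
    · by_cases h1 : m = ![1, 0, 0, 0, 0]
      · have h1' : (![1, 0, 0, 0, 0] : Fin 5 → ZMod 2) ≠ 0 := by decide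
        subst h1
        simp [h1', Fin.sum_univ_succ]
        ring
      · simp [h0, h1]
  rw [weightEnumerator_syndromeClass, Finset.sum_congr rfl fun m _ => hsplit m,
    Finset.sum_add_distrib, Finset.sum_add_distrib, Finset.sum_ite_eq' Finset.univ,
    Finset.sum_ite_eq' Finset.univ, ← Finset.sum_mul]
  simp only [Finset.mem_univ, if_true]
  ring

/-- Orthogonality of characters: only the zero syndrome pairs trivially with all messages. -/
lemma sum_signChar_dot {k : ℕ} (s : Fin k → ZMod 2) :
    ∑ m : Fin k → ZMod 2, signChar (∑ j, m j * s j) = if s = 0 then 2 ^ k else 0 := by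
  simp_rw [signChar_sum]
  rw [← Fintype.piFinset_univ, ← Finset.prod_univ_sum (fun _ => Finset.univ)
    (fun j (e : ZMod 2) => signChar (e * s j))]
  simp_rw [sum_signChar_mul, Finset.prod_ite_zero, Finset.prod_const, Finset.card_univ,
    Fintype.card_fin]
  congr 1
  simp [funext_iff]

lemma weightEnumerator_hamming16 (x y : ℂ) :
    weightEnumerator (hamming16 : Set (Fin 16 → ZMod 2)) x y =
      ((x + y) ^ 16 + 30 * ((x + y) ^ 8 * (x - y) ^ 8) + (x - y) ^ 16) / 32 := by
  have hset : (hamming16 : Set (Fin 16 → ZMod 2)) = syndromeClass reedMullerRows 0 := by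
    ext c
    exact mem_hamming16_iff c
  rw [hset, weightEnumerator_syndromeClass_reedMullerRows, sum_signChar_dot]
  simp
  ring

lemma weightEnumerator_hammingCoset_vec11 (x y : ℂ) :
    weightEnumerator (hammingCoset vec11) x y = ((x + y) ^ 8 - (x - y) ^ 8) ^ 2 / 32 := by
  have hs : (fun j => ∑ i, vec11 i * reedMullerRows j i) = ![0, 0, 0, 0, 1] := by
    decide +kernel
  have hne : (![0, 0, 0, 0, 1] : Fin 5 → ZMod 2) ≠ 0 := by decide
  rw [hammingCoset_eq_syndromeClass, hs, weightEnumerator_syndromeClass_reedMullerRows,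
    sum_signChar_dot, if_neg hne]
  simp
  ring

lemma weightEnumerator_hammingCoset_vec1 (x y : ℂ) :
    weightEnumerator (hammingCoset vec1) x y = ((x + y) ^ 16 - (x - y) ^ 16) / 32 := by
  have hs : (fun j => ∑ i, vec1 i * reedMullerRows j i) = ![1, 1, 1, 1, 1] := by
    decide +kernel
  have hne : (![1, 1, 1, 1, 1] : Fin 5 → ZMod 2) ≠ 0 := by decide
  rw [hammingCoset_eq_syndromeClass, hs, weightEnumerator_syndromeClass_reedMullerRows,
    sum_signChar_dot, if_neg hne]
  simp [signChar_one]
  ring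

/-- The parity of the weight of a binary word is the sum of its coordinates. -/
lemma sum_eq_hammingNorm {n : ℕ} (c : Fin n → ZMod 2) : ∑ i, c i = (hammingNorm c : ZMod 2) := by
  rw [hammingNorm, Finset.card_eq_sum_ones, Finset.sum_filter]
  push_cast
  refine Finset.sum_congr rfl fun i _ => ?_
  induction c i using forall_zmod_two <;> simp

/-- The MacWilliams identity for the code spanned by the all-one word of length `8`. -/
lemma weightEnumerator_syndromeClass_ones (t : ZMod 2) (x y : ℂ) :
    weightEnumerator (syndromeClass (fun (_ : Fin 1) (_ : Fin 8) => 1) fun _ => t) x y =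
      ((x + y) ^ 8 + signChar t * (x - y) ^ 8) / 2 := by
  have hconst : ∀ u, (Equiv.funUnique (Fin 1) (ZMod 2)).symm u = fun _ => u := fun _ => rfl
  have h0 : hammingNorm (encode (fun (_ : Fin 1) (_ : Fin 8) => 1) fun _ => 0) = 0 := by decide
  have h1 : hammingNorm (encode (fun (_ : Fin 1) (_ : Fin 8) => 1) fun _ => 1) = 8 := by decide
  rw [weightEnumerator_syndromeClass,
    ← (Equiv.funUnique (Fin 1) (ZMod 2)).symm.sum_comp, sum_zmod_two]
  simp only [hconst, h0, h1]
  simp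
  ring

lemma weightEnumerator_evenWords8 (x y : ℂ) :
    weightEnumerator evenWords8 x y = ((x + y) ^ 8 + (x - y) ^ 8) / 2 := by
  have hset : evenWords8 = syndromeClass (fun (_ : Fin 1) (_ : Fin 8) => 1) fun _ => 0 := by
    ext c
    simp [evenWords8, syndromeClass, sum_eq_hammingNorm, ZMod.natCast_eq_zero_iff_even]
  rw [hset, weightEnumerator_syndromeClass_ones, signChar_zero, one_mul]

lemma weightEnumerator_oddWords8 (x y : ℂ) :
    weightEnumerator oddWords8 x y = ((x + y) ^ 8 - (x - y) ^ 8) / 2 := by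
  have hset : oddWords8 = syndromeClass (fun (_ : Fin 1) (_ : Fin 8) => 1) fun _ => 1 := by
    ext c
    simp [oddWords8, syndromeClass, sum_eq_hammingNorm, ZMod.natCast_eq_one_iff_odd]
  rw [hset, weightEnumerator_syndromeClass_ones, signChar_one]
  ring

/-! ### Transformation laws of the eta function -/

/-- The primitive cube root of unity `e^(2πi/3)`; it is also the fixed point in the upper half
plane of the elliptic element of order three. -/
noncomputable def cubeRoot : ℂ := Complex.exp (2 * Real.pi * Complex.I / 3)

lemma cubeRoot_pow_three : cubeRoot ^ 3 = 1 := by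
  rw [cubeRoot, ← Complex.exp_nat_mul, ← Complex.exp_two_pi_mul_I]
  congr 1
  push_cast
  ring

lemma cubeRoot_im_pos : 0 < cubeRoot.im := by
  have h : (2 * Real.pi * Complex.I / 3 : ℂ) = ((2 * Real.pi / 3 : ℝ) : ℂ) * Complex.I := by
    push_cast
    ring
  rw [cubeRoot, h, Complex.exp_ofReal_mul_I_im]
  exact Real.sin_pos_of_pos_of_lt_pi (by positivity) (by linarith [Real.pi_pos])

lemma cubeRoot_sq_add : cubeRoot ^ 2 + cubeRoot + 1 = 0 := by
  have hne : cubeRoot - 1 ≠ 0 := by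
    intro h
    have := cubeRoot_im_pos
    rw [sub_eq_zero.1 h] at this
    simp at this
  refine mul_left_cancel₀ hne ?_
  linear_combination cubeRoot_pow_three

lemma cubeRoot_ne_zero : cubeRoot ≠ 0 := Complex.exp_ne_zero _

lemma exp_pi_div_three : Complex.exp (Real.pi * Complex.I / 3) = -cubeRoot ^ 2 := by
  rw [cubeRoot, ← Complex.exp_nat_mul]
  have h : ((2 : ℕ) * (2 * Real.pi * Complex.I / 3) : ℂ) =
      Real.pi * Complex.I / 3 + Real.pi * Complex.I := by
    push_cast
    ring
  rw [h, Complex.exp_add, Complex.exp_pi_mul_I]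
  ring

lemma qParam_eq_exp (h : ℝ) (z : ℂ) :
    Function.Periodic.qParam h z = Complex.exp (2 * Real.pi * Complex.I * z / h) := rfl

lemma norm_qParam_one_lt_one {z : ℂ} (hz : 0 < z.im) : ‖Function.Periodic.qParam 1 z‖ < 1 :=
  Function.Periodic.norm_qParam_lt_one one_pos hz

lemma eta_add_one (z : ℂ) : η (z + 1) = Complex.exp (2 * Real.pi * Complex.I / 24) * η z := by
  have h1 : Function.Periodic.qParam 1 (z + 1) = Function.Periodic.qParam 1 z := by
    rw [qParam_eq_exp, qParam_eq_exp, Complex.ofReal_one, div_one, div_one, mul_add, mul_one,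
      Complex.exp_add, Complex.exp_two_pi_mul_I, mul_one]
  have h24 : Function.Periodic.qParam 24 (z + 1) =
      Complex.exp (2 * Real.pi * Complex.I / 24) * Function.Periodic.qParam 24 z := by
    rw [qParam_eq_exp, qParam_eq_exp, ← Complex.exp_add]
    congr 1
    push_cast
    ring
  simp only [ModularForm.eta, ModularForm.eta_q, h1, h24, mul_assoc]

lemma eta_add_one_pow_eight (z : ℂ) : η (z + 1) ^ 8 = cubeRoot * η z ^ 8 := by
  rw [eta_add_one, mul_pow, ← Complex.exp_nat_mul, cubeRoot]
  congr 2
  push_cast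
  ring

lemma eta_neg_inv_pow_eight {z : ℂ} (hz : 0 < z.im) : η (-z⁻¹) ^ 8 = z ^ 4 * η z ^ 8 := by
  have hz0 : z ≠ 0 := by
    rintro rfl
    simp at hz
  have hsqrt : ∀ w : ℂ, w ≠ 0 → Complex.sqrt w ^ 8 = w ^ 4 := by
    intro w hw
    rw [Complex.sqrt, ← Complex.cpow_nat_mul]
    norm_num
  have h := ModularForm.eta_comp_eq_csqrt_I_inv hz
  simp only [Function.comp_apply, Pi.smul_apply, Pi.mul_apply, smul_eq_mul] at h
  rw [show -z⁻¹ = -1 / z by ring, h, mul_pow, mul_pow, inv_pow, hsqrt _ Complex.I_ne_zero,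
    hsqrt z hz0, Complex.I_pow_four]
  ring

lemma multipliable_one_sub_pow_odd {x : ℂ} (hx : ‖x‖ < 1) :
    Multipliable fun n : ℕ => 1 - x ^ (2 * n + 1) := by
  have hs : Summable fun n : ℕ => ‖-x ^ (2 * n + 1)‖ := by
    have := (summable_geometric_of_lt_one (norm_nonneg x) hx).comp_injective
      (i := fun n : ℕ => 2 * n + 1) fun a b hab => by simpa using hab
    simpa [Function.comp_def] using this
  simpa [sub_eq_add_neg] using multipliable_one_add_of_summable hs

lemma norm_sq_lt_one {x : ℂ} (hx : ‖x‖ < 1) : ‖x ^ 2‖ < 1 := by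
  rw [norm_pow]
  exact pow_lt_one₀ (norm_nonneg _) hx two_ne_zero

/-- `∏ (1 - xⁿ)` splits into the factors with odd and with even exponent. -/
lemma tprod_one_sub_pow_eq_odd_mul_even {x : ℂ} (hx : ‖x‖ < 1) :
    ∏' n : ℕ, (1 - x ^ (n + 1)) =
      (∏' n : ℕ, (1 - x ^ (2 * n + 1))) * ∏' n : ℕ, (1 - (x ^ 2) ^ (n + 1)) := by
  have hpow : ∀ n : ℕ, 1 - (x ^ 2) ^ (n + 1) = 1 - x ^ (2 * n + 1 + 1) := by
    intro n
    rw [← pow_mul]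
    ring_nf
  have heven := multipliable_one_sub_pow (norm_sq_lt_one hx)
  rw [tprod_congr hpow]
  exact (tprod_even_mul_odd (f := fun n : ℕ => 1 - x ^ (n + 1))
    (multipliable_one_sub_pow_odd hx) (heven.congr hpow)).symm

/-- Replacing `x` by `-x` in `φ(x) = ∏ (1 - xⁿ)`: `φ(-x) φ(x) φ(x⁴) = φ(x²)³`. -/
lemma tprod_one_sub_neg_pow {x : ℂ} (hx : ‖x‖ < 1) :
    (∏' n : ℕ, (1 - (-x) ^ (n + 1))) * (∏' n : ℕ, (1 - x ^ (n + 1))) *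
      (∏' n : ℕ, (1 - (x ^ 4) ^ (n + 1))) = (∏' n : ℕ, (1 - (x ^ 2) ^ (n + 1))) ^ 3 := by
  have hneg : ‖-x‖ < 1 := by rwa [norm_neg]
  -- the odd parts satisfy `O(-x) O(x) = O(x²)`
  have hodd : (∏' n : ℕ, (1 - (-x) ^ (2 * n + 1))) * (∏' n : ℕ, (1 - x ^ (2 * n + 1))) =
      ∏' n : ℕ, (1 - (x ^ 2) ^ (2 * n + 1)) := by
    rw [← (multipliable_one_sub_pow_odd hneg).tprod_mul (multipliable_one_sub_pow_odd hx)]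
    refine tprod_congr fun n => ?_
    rw [Odd.neg_pow ⟨n, rfl⟩]
    ring
  have hsq := tprod_one_sub_pow_eq_odd_mul_even (norm_sq_lt_one hx)
  rw [tprod_one_sub_pow_eq_odd_mul_even hneg, tprod_one_sub_pow_eq_odd_mul_even hx, neg_sq]
  rw [← pow_mul] at hsq
  calc _ = ((∏' n : ℕ, (1 - (-x) ^ (2 * n + 1))) * (∏' n : ℕ, (1 - x ^ (2 * n + 1)))) *
        (∏' n : ℕ, (1 - (x ^ 4) ^ (n + 1))) * (∏' n : ℕ, (1 - (x ^ 2) ^ (n + 1))) ^ 2 := by ring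
    _ = _ := by
      rw [hodd, ← hsq]
      ring

lemma im_half_pos {z : ℂ} (hz : 0 < z.im) : 0 < (z / 2).im := by
  simpa using hz

lemma im_add_one_half_pos {z : ℂ} (hz : 0 < z.im) : 0 < ((z + 1) / 2).im := by
  simpa using hz

lemma im_two_mul_pos {z : ℂ} (hz : 0 < z.im) : 0 < (2 * z).im := by
  simpa using hz

lemma eta_add_one_half_mul {z : ℂ} (hz : 0 < z.im) :
    η ((z + 1) / 2) * η (z / 2) * η (2 * z) =
      Complex.exp (2 * Real.pi * Complex.I / 48) * η z ^ 3 := by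
  set x := Function.Periodic.qParam 1 (z / 2) with hx
  have hx1 : ‖x‖ < 1 := norm_qParam_one_lt_one (im_half_pos hz)
  have hneg : Function.Periodic.qParam 1 ((z + 1) / 2) = -x := by
    rw [hx, qParam_eq_exp, qParam_eq_exp, neg_eq_neg_one_mul, ← Complex.exp_pi_mul_I,
      ← Complex.exp_add]
    congr 1
    push_cast
    ring
  have hsq : Function.Periodic.qParam 1 z = x ^ 2 := by
    rw [hx, qParam_eq_exp, qParam_eq_exp, ← Complex.exp_nat_mul]
    congr 1
    push_cast
    ring
  have hfour : Function.Periodic.qParam 1 (2 * z) = x ^ 4 := by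
    rw [hx, qParam_eq_exp, qParam_eq_exp, ← Complex.exp_nat_mul]
    congr 1
    push_cast
    ring
  have hq : Function.Periodic.qParam 24 ((z + 1) / 2) * Function.Periodic.qParam 24 (z / 2) *
      Function.Periodic.qParam 24 (2 * z) =
      Complex.exp (2 * Real.pi * Complex.I / 48) * Function.Periodic.qParam 24 z ^ 3 := by
    simp only [qParam_eq_exp, ← Complex.exp_nat_mul, ← Complex.exp_add]
    congr 1
    push_cast
    ring
  simp only [ModularForm.eta, ModularForm.eta_q, hneg, hsq, hfour, ← hx]
  linear_combination (∏' n : ℕ, (1 - (-x) ^ (n + 1))) * (∏' n : ℕ, (1 - x ^ (n + 1))) *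
      (∏' n : ℕ, (1 - (x ^ 4) ^ (n + 1))) * hq +
    Complex.exp (2 * Real.pi * Complex.I / 48) * Function.Periodic.qParam 24 z ^ 3 *
      tprod_one_sub_neg_pow hx1

lemma eta_add_one_half_mul_pow_eight {z : ℂ} (hz : 0 < z.im) :
    η ((z + 1) / 2) ^ 8 * (η (z / 2) ^ 8 * η (2 * z) ^ 8) = -cubeRoot ^ 2 * η z ^ 24 := by
  rw [← mul_assoc, ← mul_pow, ← mul_pow, eta_add_one_half_mul hz, mul_pow, ← pow_mul,
    ← exp_pi_div_three, ← Complex.exp_nat_mul]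
  congr 2
  push_cast
  ring

lemma eta_half_neg_inv_pow_eight {z : ℂ} (hz : 0 < z.im) :
    η (-z⁻¹ / 2) ^ 8 = 16 * z ^ 4 * η (2 * z) ^ 8 := by
  rw [show -z⁻¹ / 2 = -(2 * z)⁻¹ by rw [mul_inv]; ring, eta_neg_inv_pow_eight (im_two_mul_pos hz)]
  ring

lemma eta_two_mul_neg_inv_pow_eight {z : ℂ} (hz : 0 < z.im) :
    16 * η (2 * -z⁻¹) ^ 8 = z ^ 4 * η (z / 2) ^ 8 := by
  rw [show 2 * -z⁻¹ = -(z / 2)⁻¹ by rw [inv_div]; ring, eta_neg_inv_pow_eight (im_half_pos hz)]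
  ring

lemma im_neg_inv_pos {z : ℂ} (hz : 0 < z.im) : 0 < (-z⁻¹).im := by
  have := UpperHalfPlane.im_inv_neg_coe_pos ⟨z, hz⟩
  rwa [inv_neg] at this

/-- Instead of decomposing the matrix that takes `(z+1)/2` to `(-1/z+1)/2` into generators, the law
is read off from those of the three factors of `η(z)³ / (η(z/2) η(2z))`. -/
lemma eta_add_one_half_neg_inv_pow_eight {z : ℂ} (hz : 0 < z.im) :
    η ((-z⁻¹ + 1) / 2) ^ 8 = z ^ 4 * η ((z + 1) / 2) ^ 8 := by
  have hz0 : z ≠ 0 := by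
    rintro rfl
    simp at hz
  have h1 := eta_add_one_half_mul_pow_eight (im_neg_inv_pos hz)
  have h2 := eta_add_one_half_mul_pow_eight hz
  -- the cube of `eta_neg_inv_pow_eight`, by `x³ - y³ = (x² + xy + y²)(x - y)`
  have h24 : η (-z⁻¹) ^ 24 = z ^ 12 * η z ^ 24 := by
    linear_combination ((η (-z⁻¹) ^ 8) ^ 2 + η (-z⁻¹) ^ 8 * (z ^ 4 * η z ^ 8) +
      (z ^ 4 * η z ^ 8) ^ 2) * eta_neg_inv_pow_eight hz
  have hA : η (z / 2) ≠ 0 := ModularForm.eta_ne_zero (im_half_pos hz)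
  have hC : η (2 * z) ≠ 0 := ModularForm.eta_ne_zero (im_two_mul_pos hz)
  have hne : z ^ 8 * (η (z / 2) ^ 8 * η (2 * z) ^ 8) ≠ 0 := by positivity
  refine mul_right_cancel₀ hne ?_
  rw [h24, eta_half_neg_inv_pow_eight hz] at h1
  linear_combination h1 - z ^ 12 * h2 - η ((-z⁻¹ + 1) / 2) ^ 8 * z ^ 4 * η (2 * z) ^ 8 *
    eta_two_mul_neg_inv_pow_eight hz

/-! ### Jacobi's quartic identity -/

/-- The combination `η(z/2)⁸ + 16 η(2z)⁸ + e^(2πi/3) η((z+1)/2)⁸`, which transforms under the full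
modular group with a character of order three, and which vanishes by `jacobiForm_eq_zero`. -/
noncomputable def jacobiForm (z : ℂ) : ℂ :=
  η (z / 2) ^ 8 + 16 * η (2 * z) ^ 8 + cubeRoot * η ((z + 1) / 2) ^ 8

lemma jacobiForm_add_one (z : ℂ) : jacobiForm (z + 1) = cubeRoot ^ 2 * jacobiForm z := by
  have h1 : η ((z + 1 + 1) / 2) ^ 8 = cubeRoot * η (z / 2) ^ 8 := by
    rw [show (z + 1 + 1) / 2 = z / 2 + 1 by ring, eta_add_one_pow_eight]
  have h2 : η (2 * (z + 1)) ^ 8 = cubeRoot ^ 2 * η (2 * z) ^ 8 := by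
    rw [show 2 * (z + 1) = 2 * z + 1 + 1 by ring, eta_add_one_pow_eight, eta_add_one_pow_eight]
    ring
  rw [jacobiForm, jacobiForm, h1, h2]
  linear_combination -η ((z + 1) / 2) ^ 8 * cubeRoot_pow_three

lemma jacobiForm_neg_inv {z : ℂ} (hz : 0 < z.im) : jacobiForm (-z⁻¹) = z ^ 4 * jacobiForm z := by
  rw [jacobiForm, jacobiForm]
  linear_combination eta_half_neg_inv_pow_eight hz + eta_two_mul_neg_inv_pow_eight hz +
    cubeRoot * eta_add_one_half_neg_inv_pow_eight hz

lemma jacobiForm_cubeRoot : jacobiForm cubeRoot = 0 := by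
  -- at this point `z ↦ -1/z` and `z ↦ z + 1` agree, but the two laws give different factors
  have hfix : -cubeRoot⁻¹ = cubeRoot + 1 := by
    have h0 := cubeRoot_ne_zero
    field_simp
    linear_combination -cubeRoot_sq_add
  have h := jacobiForm_neg_inv cubeRoot_im_pos
  rw [hfix, jacobiForm_add_one] at h
  have hne : cubeRoot ^ 2 - cubeRoot ^ 4 ≠ 0 := by
    intro h0
    have him := cubeRoot_im_pos
    have h1 : cubeRoot = -1 / 2 := by
      linear_combination (1 / 2 : ℂ) * cubeRoot_sq_add - (1 / 2 : ℂ) * h0 -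
        (1 / 2 : ℂ) * cubeRoot * cubeRoot_pow_three
    rw [h1] at him
    norm_num at him
  exact (mul_eq_zero.1 (by linear_combination h : (cubeRoot ^ 2 - cubeRoot ^ 4) *
    jacobiForm cubeRoot = 0)).resolve_left hne

lemma tendsto_eta_tprod :
    Filter.Tendsto (fun z : ℂ => ∏' n, (1 - ModularForm.eta_q n z))
      (Filter.comap Complex.im Filter.atTop) (nhds 1) := by
  have hcont : ContinuousAt (fun q : ℂ => ∏' n : ℕ, (1 - q ^ (n + 1))) 0 :=
    (differentiableOn_tprod_one_sub_pow.differentiableAt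
      (Metric.ball_mem_nhds 0 one_pos)).continuousAt
  have h := hcont.tendsto.comp
    ((Function.Periodic.qParam_tendsto one_pos).mono_right nhdsWithin_le_nhds)
  simpa [Function.comp_def] using h

lemma tendsto_eta :
    Filter.Tendsto ModularForm.eta (Filter.comap Complex.im Filter.atTop) (nhds 0) := by
  have h := ((Function.Periodic.qParam_tendsto (h := 24) (by norm_num)).mono_right
    nhdsWithin_le_nhds).mul tendsto_eta_tprod
  rwa [zero_mul] at h

lemma tendsto_qParam_div_eta :
    Filter.Tendsto (fun z : ℂ => Function.Periodic.qParam 24 z / η z)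
      (Filter.comap Complex.im Filter.atTop) (nhds 1) := by
  have h := tendsto_eta_tprod.inv₀ one_ne_zero
  rw [inv_one] at h
  refine h.congr fun z => ?_
  rw [ModularForm.eta, div_mul_eq_div_div, div_self (Function.Periodic.qParam_ne_zero z), one_div]

lemma tendsto_im_atImInfty (f : ℍ → ℂ) {c : ℝ} (hc : 0 < c) (hf : ∀ τ : ℍ, (f τ).im = c * τ.im) :
    Filter.Tendsto f atImInfty (Filter.comap Complex.im Filter.atTop) := by
  rw [Filter.tendsto_comap_iff]
  have h : Complex.im ∘ f = fun τ : ℍ => c * τ.im := funext hf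
  rw [h]
  exact Filter.tendsto_comap.const_mul_atTop hc

lemma tendsto_half_atImInfty : Filter.Tendsto (fun τ : ℍ => (τ : ℂ) / 2) atImInfty
    (Filter.comap Complex.im Filter.atTop) :=
  tendsto_im_atImInfty _ (c := 1 / 2) (by norm_num) fun τ => by simp; ring

lemma tendsto_add_one_half_atImInfty : Filter.Tendsto (fun τ : ℍ => ((τ : ℂ) + 1) / 2) atImInfty
    (Filter.comap Complex.im Filter.atTop) :=
  tendsto_im_atImInfty _ (c := 1 / 2) (by norm_num) fun τ => by simp; ring

lemma tendsto_two_mul_atImInfty : Filter.Tendsto (fun τ : ℍ => 2 * (τ : ℂ)) atImInfty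
    (Filter.comap Complex.im Filter.atTop) :=
  tendsto_im_atImInfty _ (c := 2) (by norm_num) fun τ => by simp

lemma isZeroAtImInfty_jacobiForm : IsZeroAtImInfty fun τ : ℍ => jacobiForm τ := by
  have h := (((tendsto_eta.comp tendsto_half_atImInfty).pow 8).add
    (((tendsto_eta.comp tendsto_two_mul_atImInfty).pow 8).const_mul 16)).add
    (((tendsto_eta.comp tendsto_add_one_half_atImInfty).pow 8).const_mul cubeRoot)
  norm_num at h
  exact h

/-- A function on `ℂ` that is differentiable on the open upper half plane is holomorphic there in
the sense of manifolds. -/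
lemma mdifferentiable_of_differentiableAt {f : ℂ → ℂ}
    (hf : ∀ z : ℂ, 0 < z.im → DifferentiableAt ℂ f z) : MDiff (fun τ : ℍ => f τ) := by
  rw [UpperHalfPlane.mdifferentiable_iff]
  refine DifferentiableOn.congr (f := f) (fun z hz => (hf z hz).differentiableWithinAt) ?_
  intro z hz
  simp [Function.comp_apply, ofComplex_apply_of_im_pos hz]

lemma differentiableAt_eta_comp {f : ℂ → ℂ} {z : ℂ} (hf : DifferentiableAt ℂ f z)
    (him : 0 < (f z).im) : DifferentiableAt ℂ (fun w => η (f w)) z :=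
  (ModularForm.differentiableAt_eta_of_mem_upperHalfPlaneSet him).comp z hf

lemma differentiableAt_jacobiForm {z : ℂ} (hz : 0 < z.im) : DifferentiableAt ℂ jacobiForm z := by
  have h1 := differentiableAt_eta_comp (f := fun w => w / 2) (by fun_prop) (im_half_pos hz)
  have h2 := differentiableAt_eta_comp (f := fun w => 2 * w) (by fun_prop) (im_two_mul_pos hz)
  have h3 := differentiableAt_eta_comp (f := fun w => (w + 1) / 2) (by fun_prop)
    (im_add_one_half_pos hz)
  exact ((h1.pow 8).add ((h2.pow 8).const_mul 16)).add ((h3.pow 8).const_mul cubeRoot)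

lemma coe_T_smul (τ : ℍ) : ((ModularGroup.T • τ : ℍ) : ℂ) = τ + 1 := by
  rw [UpperHalfPlane.modular_T_smul]
  simp [add_comm]

lemma coe_S_smul (τ : ℍ) : ((ModularGroup.S • τ : ℍ) : ℂ) = -(τ : ℂ)⁻¹ := by
  rw [UpperHalfPlane.modular_S_smul]
  simp [inv_neg]

lemma slash_T_apply (k : ℤ) (f : ℍ → ℂ) (τ : ℍ) :
    (f ∣[k] ModularGroup.T) τ = f (ModularGroup.T • τ) := by
  have hden : denom (ModularGroup.T : GL (Fin 2) ℝ) τ = 1 := by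
    rw [UpperHalfPlane.denom]
    simp [ModularGroup.coe_T]
  rw [ModularForm.SL_slash_apply, hden, one_zpow, mul_one]

lemma slash_S_apply (k : ℤ) (f : ℍ → ℂ) (τ : ℍ) :
    (f ∣[k] ModularGroup.S) τ = f (ModularGroup.S • τ) * (τ : ℂ) ^ (-k) := by
  rw [ModularForm.SL_slash_apply, ModularGroup.denom_S]

lemma jacobiForm_cube_slash (γ : SL(2, ℤ)) :
    (fun τ : ℍ => jacobiForm τ ^ 3) ∣[(12 : ℤ)] γ = fun τ : ℍ => jacobiForm τ ^ 3 := by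
  refine SlashInvariantForm.slash_action_generators_SL2Z ?_ ?_ γ
  · ext τ
    rw [slash_S_apply, coe_S_smul, jacobiForm_neg_inv τ.im_pos]
    have h0 := UpperHalfPlane.ne_zero τ
    simp only [zpow_neg]
    norm_cast
    field_simp
  · ext τ
    rw [slash_T_apply, coe_T_smul, jacobiForm_add_one]
    linear_combination (cubeRoot ^ 3 + 1) * jacobiForm τ ^ 3 * cubeRoot_pow_three

/-- The cube of `jacobiForm` as a cusp form of weight `12` and level one. -/
noncomputable def jacobiCuspForm : CuspForm 𝒮ℒ 12 where
  toFun τ := jacobiForm τ ^ 3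
  slash_action_eq' A hA := by
    obtain ⟨A, rfl⟩ := hA
    exact jacobiForm_cube_slash A
  holo' := mdifferentiable_of_differentiableAt fun _ hz => (differentiableAt_jacobiForm hz).pow 3
  zero_at_cusps' hc := by
    rw [Subgroup.IsArithmetic.isCusp_iff_isCusp_SL2Z] at hc
    rw [OnePoint.isZeroAt_iff_forall_SL2Z hc]
    intro γ _
    rw [jacobiForm_cube_slash]
    have h := Filter.Tendsto.pow isZeroAtImInfty_jacobiForm 3
    rwa [zero_pow three_ne_zero] at h

/-- Cusp forms of weight `12` are multiples of the discriminant, which has no zeros in the upper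
half plane, whereas `jacobiForm` vanishes at `e^(2πi/3)`. -/
lemma jacobiForm_eq_zero {z : ℂ} (hz : 0 < z.im) : jacobiForm z = 0 := by
  let g : ModularForm 𝒮ℒ 0 := (CuspForm.discriminantEquiv jacobiCuspForm).mcast (by norm_num)
  obtain ⟨c, hc⟩ := ModularFormClass.levelOne_weight_zero_const g
  have happ : ∀ τ : ℍ, jacobiForm τ ^ 3 = c * ModularForm.discriminant τ := by
    intro τ
    have h : jacobiForm τ ^ 3 / ModularForm.discriminant τ = c := congrFun hc τ
    rw [← h, div_mul_cancel₀ _ (ModularForm.discriminant_ne_zero τ)]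
  have hc0 : c = 0 := by
    have h := happ ⟨cubeRoot, cubeRoot_im_pos⟩
    rw [UpperHalfPlane.coe_mk, jacobiForm_cubeRoot, zero_pow three_ne_zero] at h
    exact (mul_eq_zero.1 h.symm).resolve_right (ModularForm.discriminant_ne_zero _)
  have h := happ ⟨z, hz⟩
  rw [hc0, zero_mul] at h
  exact eq_zero_of_pow_eq_zero h

/-- Jacobi's identity `θ₃⁴ = θ₂⁴ + θ₄⁴`, written in terms of eta quotients. -/
theorem eta_jacobi_identity {z : ℂ} (hz : 0 < z.im) :
    η (z / 2) ^ 16 * η (2 * z) ^ 8 + 16 * η (z / 2) ^ 8 * η (2 * z) ^ 16 = η z ^ 24 := by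
  have h := jacobiForm_eq_zero hz
  rw [jacobiForm] at h
  linear_combination η (z / 2) ^ 8 * η (2 * z) ^ 8 * h -
    cubeRoot * eta_add_one_half_mul_pow_eight hz + η z ^ 24 * cubeRoot_pow_three

/-! ### The identities between `h`, `g₀`, `g₁` and the string functions -/

lemma c₀_add_c₁ (z : ℂ) : c₀ z + c₁ z = η z / (η (2 * z) * η (z / 2)) := by
  rw [c₀, c₁]
  ring

lemma c₀_sub_c₁ (z : ℂ) : c₀ z - c₁ z = η (z / 2) / η z ^ 2 := by
  rw [c₀, c₁]
  ring

lemma h_half (z : ℂ) : h (z / 2) = (η (z / 2) ^ 8)⁻¹ * (η z ^ 8)⁻¹ := by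
  rw [h, mul_div_cancel₀ _ (two_ne_zero' ℂ)]

lemma h_add_one_half_eq (z : ℂ) :
    h ((z + 1) / 2) = (η ((z + 1) / 2) ^ 8)⁻¹ * (cubeRoot * η z ^ 8)⁻¹ := by
  rw [h, mul_div_cancel₀ _ (two_ne_zero' ℂ), eta_add_one_pow_eight]

lemma h_add_one_half {z : ℂ} (hz : 0 < z.im) :
    h ((z + 1) / 2) = -(η (z / 2) ^ 8 * η (2 * z) ^ 8) / η z ^ 32 := by
  have hB : η z ≠ 0 := ModularForm.eta_ne_zero hz
  have hE : η ((z + 1) / 2) ≠ 0 := ModularForm.eta_ne_zero (im_add_one_half_pos hz)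
  have hw := cubeRoot_ne_zero
  have hprod := eta_add_one_half_mul_pow_eight hz
  have hcube := cubeRoot_pow_three
  rw [h_add_one_half_eq]
  generalize η ((z + 1) / 2) = E at *
  generalize η (z / 2) = A at *
  generalize η (2 * z) = C at *
  generalize η z = B at *
  field_simp
  linear_combination cubeRoot * hprod - B ^ 24 * hcube

lemma g₀_eq {z : ℂ} (hz : 0 < z.im) :
    g₀ z = ((c₀ z + c₁ z) ^ 8 - (c₀ z - c₁ z) ^ 8) / 2 * c₂ z ^ 8 := by
  have hA : η (z / 2) ≠ 0 := ModularForm.eta_ne_zero (im_half_pos hz)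
  have hB : η z ≠ 0 := ModularForm.eta_ne_zero hz
  have hC : η (2 * z) ≠ 0 := ModularForm.eta_ne_zero (im_two_mul_pos hz)
  rw [g₀, h_half, h_add_one_half hz, c₀_add_c₁, c₀_sub_c₁, c₂]
  generalize η (z / 2) = A at *
  generalize η (2 * z) = C at *
  generalize η z = B at *
  field_simp
  ring

lemma g₁_eq {z : ℂ} (hz : 0 < z.im) :
    g₁ z = ((c₀ z + c₁ z) ^ 8 + (c₀ z - c₁ z) ^ 8) / 2 * c₂ z ^ 8 := by
  have hA : η (z / 2) ≠ 0 := ModularForm.eta_ne_zero (im_half_pos hz)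
  have hB : η z ≠ 0 := ModularForm.eta_ne_zero hz
  have hC : η (2 * z) ≠ 0 := ModularForm.eta_ne_zero (im_two_mul_pos hz)
  rw [g₁, h_half, h_add_one_half hz, c₀_add_c₁, c₀_sub_c₁, c₂]
  generalize η (z / 2) = A at *
  generalize η (2 * z) = C at *
  generalize η z = B at *
  field_simp
  ring

lemma h_eq {z : ℂ} (hz : 0 < z.im) : h z = (c₀ z + c₁ z) ^ 8 * (c₀ z - c₁ z) ^ 8 := by
  have hA : η (z / 2) ≠ 0 := ModularForm.eta_ne_zero (im_half_pos hz)
  have hB : η z ≠ 0 := ModularForm.eta_ne_zero hz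
  have hC : η (2 * z) ≠ 0 := ModularForm.eta_ne_zero (im_two_mul_pos hz)
  rw [h, c₀_add_c₁, c₀_sub_c₁]
  field_simp

/-- Jacobi's identity `eta_jacobi_identity` in terms of the string functions. -/
lemma c₀_add_c₁_pow_sub {z : ℂ} (hz : 0 < z.im) :
    (c₀ z + c₁ z) ^ 8 - (c₀ z - c₁ z) ^ 8 = 16 * c₂ z ^ 8 := by
  have hA : η (z / 2) ≠ 0 := ModularForm.eta_ne_zero (im_half_pos hz)
  have hB : η z ≠ 0 := ModularForm.eta_ne_zero hz
  have hC : η (2 * z) ≠ 0 := ModularForm.eta_ne_zero (im_two_mul_pos hz)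
  rw [c₀_add_c₁, c₀_sub_c₁, c₂]
  field_simp
  linear_combination -eta_jacobi_identity hz

/-! ### Modularity of `g₀ + h`, `g₀` and `g₁` -/

lemma h_add_one (z : ℂ) : h (z + 1) = h z := by
  rw [h, h, show 2 * (z + 1) = 2 * z + 1 + 1 by ring, eta_add_one_pow_eight, eta_add_one_pow_eight,
    eta_add_one_pow_eight, ← mul_inv, ← mul_inv]
  congr 1
  linear_combination η z ^ 8 * η (2 * z) ^ 8 * cubeRoot_pow_three

lemma h_neg_inv {z : ℂ} (hz : 0 < z.im) : h (-z⁻¹) * z ^ 8 = 16 * h (z / 2) := by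
  have hz0 : z ≠ 0 := by
    rintro rfl
    simp at hz
  have hC : η (2 * -z⁻¹) ^ 8 = z ^ 4 * η (z / 2) ^ 8 / 16 := by
    rw [← eta_two_mul_neg_inv_pow_eight hz]
    ring
  have hA : η (z / 2) ≠ 0 := ModularForm.eta_ne_zero (im_half_pos hz)
  have hB : η z ≠ 0 := ModularForm.eta_ne_zero hz
  rw [h_half, h, eta_neg_inv_pow_eight hz, hC]
  generalize η (z / 2) = A at *
  field_simp

lemma h_half_neg_inv {z : ℂ} (hz : 0 < z.im) : h (-z⁻¹ / 2) * z ^ 8 = h z / 16 := by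
  have hz0 : z ≠ 0 := by
    rintro rfl
    simp at hz
  have hB : η z ≠ 0 := ModularForm.eta_ne_zero hz
  have hC : η (2 * z) ≠ 0 := ModularForm.eta_ne_zero (im_two_mul_pos hz)
  rw [h_half, h, eta_neg_inv_pow_eight hz, eta_half_neg_inv_pow_eight hz]
  field_simp

lemma h_add_one_half_neg_inv {z : ℂ} (hz : 0 < z.im) :
    h ((-z⁻¹ + 1) / 2) * z ^ 8 = h ((z + 1) / 2) := by
  have hz0 : z ≠ 0 := by
    rintro rfl
    simp at hz
  have hB : η z ≠ 0 := ModularForm.eta_ne_zero hz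
  have hE : η ((z + 1) / 2) ≠ 0 := ModularForm.eta_ne_zero (im_add_one_half_pos hz)
  have hw := cubeRoot_ne_zero
  rw [h_add_one_half_eq, h_add_one_half_eq, eta_neg_inv_pow_eight hz,
    eta_add_one_half_neg_inv_pow_eight hz]
  generalize η ((z + 1) / 2) = E at *
  field_simp

/-- For a nonzero row vector `v` over `ZMod 2`, the translate of `h` belonging to `v`: `h(τ)/16`,
`h(τ/2)` and `h((τ+1)/2)` for `v = (0, 1)`, `(1, 0)` and `(1, 1)`. The factor `1/16` makes
`SL₂(ℤ)` permute the three functions without further constants. -/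
noncomputable def hTranslate (v : Fin 2 → ZMod 2) (τ : ℍ) : ℂ :=
  if v = ![0, 1] then h τ / 16 else if v = ![1, 0] then h (τ / 2) else
    if v = ![1, 1] then h ((τ + 1) / 2) else 0

lemma hTranslate_zero : hTranslate 0 = 0 := by
  funext τ
  rw [hTranslate, if_neg (by decide), if_neg (by decide), if_neg (by decide), Pi.zero_apply]

lemma hTranslate_zero_one (τ : ℍ) : hTranslate ![0, 1] τ = h τ / 16 := if_pos rfl

lemma hTranslate_one_zero (τ : ℍ) : hTranslate ![1, 0] τ = h (τ / 2) := by
  rw [hTranslate, if_neg (by decide), if_pos rfl]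

lemma hTranslate_one_one (τ : ℍ) : hTranslate ![1, 1] τ = h ((τ + 1) / 2) := by
  rw [hTranslate, if_neg (by decide), if_neg (by decide), if_pos rfl]

lemma forall_row_zmod_two {p : (Fin 2 → ZMod 2) → Prop} (h00 : p 0) (h01 : p ![0, 1])
    (h10 : p ![1, 0]) (h11 : p ![1, 1]) (v : Fin 2 → ZMod 2) : p v := by
  have hv : ∀ v : Fin 2 → ZMod 2, v = 0 ∨ v = ![0, 1] ∨ v = ![1, 0] ∨ v = ![1, 1] := by decide
  rcases hv v with rfl | rfl | rfl | rfl
  exacts [h00, h01, h10, h11]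

/-- The right action of `SL₂(ℤ)` on row vectors modulo `2`. -/
def rowMul (v : Fin 2 → ZMod 2) (γ : SL(2, ℤ)) : Fin 2 → ZMod 2 :=
  Matrix.vecMul v ((γ : Matrix (Fin 2) (Fin 2) ℤ).map (Int.castRingHom (ZMod 2)))

lemma rowMul_one (v : Fin 2 → ZMod 2) : rowMul v 1 = v := by
  rw [rowMul, Matrix.SpecialLinearGroup.coe_one, Matrix.map_one _ (map_zero _) (map_one _),
    Matrix.vecMul_one]

lemma rowMul_mul (v : Fin 2 → ZMod 2) (γ δ : SL(2, ℤ)) :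
    rowMul v (γ * δ) = rowMul (rowMul v γ) δ := by
  rw [rowMul, rowMul, rowMul, Matrix.SpecialLinearGroup.coe_mul, Matrix.map_mul,
    Matrix.vecMul_vecMul]

lemma rowMul_of_mem_Gamma {γ : SL(2, ℤ)} (hγ : γ ∈ CongruenceSubgroup.Gamma 2)
    (v : Fin 2 → ZMod 2) : rowMul v γ = v := by
  obtain ⟨h00, h01, h10, h11⟩ := CongruenceSubgroup.Gamma_mem.1 hγ
  funext j
  fin_cases j <;> simp [rowMul, Matrix.vecMul, dotProduct, Fin.sum_univ_two, h00, h01, h10, h11]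

lemma hTranslate_slash_T (v : Fin 2 → ZMod 2) :
    hTranslate v ∣[(-8 : ℤ)] ModularGroup.T = hTranslate (rowMul v ModularGroup.T) := by
  have e01 : rowMul ![0, 1] ModularGroup.T = ![0, 1] := by decide
  have e10 : rowMul ![1, 0] ModularGroup.T = ![1, 1] := by decide
  have e11 : rowMul ![1, 1] ModularGroup.T = ![1, 0] := by decide
  have e00 : rowMul 0 ModularGroup.T = 0 := by decide
  funext τ
  rw [slash_T_apply]
  induction v using forall_row_zmod_two
  · rw [e00, hTranslate_zero, Pi.zero_apply, Pi.zero_apply]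
  · rw [e01, hTranslate_zero_one, hTranslate_zero_one, coe_T_smul, h_add_one]
  · rw [e10, hTranslate_one_zero, hTranslate_one_one, coe_T_smul]
  · rw [e11, hTranslate_one_zero, hTranslate_one_one, coe_T_smul,
      show ((τ : ℂ) + 1 + 1) / 2 = τ / 2 + 1 by ring, h_add_one]

lemma hTranslate_slash_S (v : Fin 2 → ZMod 2) :
    hTranslate v ∣[(-8 : ℤ)] ModularGroup.S = hTranslate (rowMul v ModularGroup.S) := by
  have e01 : rowMul ![0, 1] ModularGroup.S = ![1, 0] := by decide
  have e10 : rowMul ![1, 0] ModularGroup.S = ![0, 1] := by decide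
  have e11 : rowMul ![1, 1] ModularGroup.S = ![1, 1] := by decide
  have e00 : rowMul 0 ModularGroup.S = 0 := by decide
  have hpow : (τ : ℍ) → (τ : ℂ) ^ (-(-8 : ℤ)) = (τ : ℂ) ^ 8 := fun τ => by norm_cast
  funext τ
  rw [slash_S_apply, hpow]
  induction v using forall_row_zmod_two
  · rw [e00, hTranslate_zero, Pi.zero_apply, Pi.zero_apply, zero_mul]
  · rw [e01, hTranslate_zero_one, hTranslate_one_zero, coe_S_smul]
    linear_combination (1 / 16 : ℂ) * h_neg_inv τ.im_pos
  · rw [e10, hTranslate_one_zero, hTranslate_zero_one, coe_S_smul, h_half_neg_inv τ.im_pos]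
  · rw [e11, hTranslate_one_one, hTranslate_one_one, coe_S_smul, h_add_one_half_neg_inv τ.im_pos]

/-- `SL₂(ℤ)` permutes the translates of `h` through its action on the row vectors modulo `2`. -/
theorem hTranslate_slash (γ : SL(2, ℤ)) :
    ∀ v, hTranslate v ∣[(-8 : ℤ)] γ = hTranslate (rowMul v γ) := by
  have hγ : γ ∈ Subgroup.closure {ModularGroup.S, ModularGroup.T} := by
    rw [SpecialLinearGroup.SL2Z_generators]
    exact Subgroup.mem_top γ
  induction hγ using Subgroup.closure_induction with
  | mem x hx =>
    rcases hx with rfl | rfl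
    exacts [hTranslate_slash_S, hTranslate_slash_T]
  | one => exact fun v => by rw [SlashAction.slash_one, rowMul_one]
  | mul x y _ _ hx hy => exact fun v => by rw [SlashAction.slash_mul, hx, hy, rowMul_mul]
  | inv x _ hx =>
    intro v
    have hv : rowMul (rowMul v x⁻¹) x = v := by rw [← rowMul_mul, inv_mul_cancel, rowMul_one]
    have h := congrArg (fun f => f ∣[(-8 : ℤ)] x⁻¹) (hx (rowMul v x⁻¹))
    simp only [hv, ← SlashAction.slash_mul, mul_inv_cancel, SlashAction.slash_one] at h
    exact h.symm

lemma differentiableAt_h_comp {f : ℂ → ℂ} {z : ℂ} (hf : DifferentiableAt ℂ f z)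
    (him : 0 < (f z).im) : DifferentiableAt ℂ (fun w => h (f w)) z := by
  have h1 := differentiableAt_eta_comp hf him
  have h2 := differentiableAt_eta_comp (hf.const_mul 2) (im_two_mul_pos him)
  exact ((h1.pow 8).inv (pow_ne_zero 8 (ModularForm.eta_ne_zero him))).mul
    ((h2.pow 8).inv (pow_ne_zero 8 (ModularForm.eta_ne_zero (im_two_mul_pos him))))

lemma mdifferentiable_hTranslate (v : Fin 2 → ZMod 2) : MDiff (hTranslate v) := by
  induction v using forall_row_zmod_two
  · rw [hTranslate_zero]
    exact mdifferentiable_of_differentiableAt (f := fun _ => 0) fun z _ => by fun_prop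
  · rw [funext hTranslate_zero_one]
    exact mdifferentiable_of_differentiableAt (f := fun z => h z / 16) fun z hz =>
      (differentiableAt_h_comp (f := fun w => w) (by fun_prop) hz).div_const 16
  · rw [funext hTranslate_one_zero]
    exact mdifferentiable_of_differentiableAt (f := fun z => h (z / 2)) fun z hz =>
      differentiableAt_h_comp (f := fun w => w / 2) (by fun_prop) (im_half_pos hz)
  · rw [funext hTranslate_one_one]
    exact mdifferentiable_of_differentiableAt (f := fun z => h ((z + 1) / 2)) fun z hz =>
      differentiableAt_h_comp (f := fun w => (w + 1) / 2) (by fun_prop) (im_add_one_half_pos hz)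

/-- The expansion of `h` at infinity starts with `q⁻¹`. -/
lemma tendsto_qParam_mul_h :
    Filter.Tendsto (fun z : ℂ => Function.Periodic.qParam 1 z * h z)
      (Filter.comap Complex.im Filter.atTop) (nhds 1) := by
  have htwo : Filter.Tendsto (fun z : ℂ => 2 * z) (Filter.comap Complex.im Filter.atTop)
      (Filter.comap Complex.im Filter.atTop) := by
    rw [Filter.tendsto_comap_iff]
    have h2 : (Complex.im ∘ fun z : ℂ => 2 * z) = fun z : ℂ => 2 * z.im := by
      funext z
      simp
    rw [h2]
    exact Filter.tendsto_comap.const_mul_atTop two_pos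
  have hlim := (tendsto_qParam_div_eta.pow 8).mul ((tendsto_qParam_div_eta.comp htwo).pow 8)
  rw [one_pow, mul_one] at hlim
  refine hlim.congr fun z => ?_
  have hq : Function.Periodic.qParam 24 z ^ 8 * Function.Periodic.qParam 24 (2 * z) ^ 8 =
      Function.Periodic.qParam 1 z := by
    simp only [qParam_eq_exp, ← Complex.exp_nat_mul, ← Complex.exp_add]
    congr 1
    push_cast
    ring
  rw [Function.comp_apply, h, div_pow, div_pow, ← hq]
  ring

/-- At `w = τ/2` and `w = (τ+1)/2` one has `q(τ) = q(w)²`, so that `q(τ) h(w)` even tends to zero. -/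
lemma tendsto_qParam_mul_h_comp {f : ℍ → ℂ}
    (hf : Filter.Tendsto f atImInfty (Filter.comap Complex.im Filter.atTop))
    (hq : ∀ τ : ℍ, Function.Periodic.qParam 1 τ = Function.Periodic.qParam 1 (f τ) ^ 2) :
    Filter.Tendsto (fun τ : ℍ => Function.Periodic.qParam 1 τ * h (f τ)) atImInfty (nhds 0) := by
  have hlim := (((Function.Periodic.qParam_tendsto one_pos).mono_right
    nhdsWithin_le_nhds).comp hf).mul (tendsto_qParam_mul_h.comp hf)
  rw [zero_mul] at hlim
  refine hlim.congr fun τ => ?_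
  rw [hq τ, Function.comp_apply, Function.comp_apply]
  ring

lemma isBoundedAtImInfty_qParam_mul_hTranslate (v : Fin 2 → ZMod 2) :
    IsBoundedAtImInfty fun τ : ℍ => Function.Periodic.qParam 1 τ * hTranslate v τ := by
  induction v using forall_row_zmod_two
  · rw [hTranslate_zero]
    simp only [Pi.zero_apply, mul_zero]
    exact Filter.const_boundedAtFilter atImInfty (0 : ℂ)
  · simp only [hTranslate_zero_one, ← mul_div_assoc]
    have hcoe := tendsto_im_atImInfty (fun τ : ℍ => (τ : ℂ)) one_pos fun τ => by simp
    exact ((tendsto_qParam_mul_h.comp hcoe).div_const 16).isBigO_one ℝ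
  · simp only [hTranslate_one_zero]
    refine (tendsto_qParam_mul_h_comp tendsto_half_atImInfty fun τ => ?_).isBigO_one ℝ
    rw [qParam_eq_exp, qParam_eq_exp, ← Complex.exp_nat_mul]
    congr 1
    push_cast
    ring
  · simp only [hTranslate_one_one]
    refine (tendsto_qParam_mul_h_comp tendsto_add_one_half_atImInfty fun τ => ?_).isBigO_one ℝ
    have hexp : ((2 : ℕ) : ℂ) * (2 * Real.pi * Complex.I * ((τ + 1) / 2) / (1 : ℝ)) =
        2 * Real.pi * Complex.I * τ / (1 : ℝ) + 2 * Real.pi * Complex.I := by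
      push_cast
      ring
    rw [qParam_eq_exp, qParam_eq_exp, ← Complex.exp_nat_mul, hexp, Complex.exp_add,
      Complex.exp_two_pi_mul_I, mul_one]

/-- In weight `-8` the square root `φ` only enters through `φ¹⁶ = (cτ + d)⁸`, so the metaplectic
action is the usual one of `SL₂(ℤ)`. -/
lemma mpSlash_eq_slash (f : ℍ → ℂ) (γ : Mp2Z) : mpSlash (-8) f γ = f ∣[(-8 : ℤ)] γ.mat := by
  funext τ
  rw [mpSlash, ModularForm.SL_slash_apply, UpperHalfPlane.denom]
  have hroot : γ.root τ ^ (-2 * (-8) : ℤ) = (γ.root τ ^ 2) ^ 8 := by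
    rw [← pow_mul]
    norm_cast
  rw [hroot, γ.root_sq, mul_comm]
  congr 1

lemma slash_sum_hTranslate (c : (Fin 2 → ZMod 2) → ℂ) (γ : SL(2, ℤ)) :
    (fun τ => ∑ v, c v * hTranslate v τ) ∣[(-8 : ℤ)] γ =
      fun τ => ∑ v, c v * hTranslate (rowMul v γ) τ := by
  funext τ
  rw [ModularForm.SL_slash_apply, Finset.sum_mul]
  refine Finset.sum_congr rfl fun v _ => ?_
  rw [← hTranslate_slash, ModularForm.SL_slash_apply, mul_assoc]

/-- The translates of `h` are modular functions even for `Γ(2)`, which contains `Γ(16)`. -/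
theorem isModularFunction_sum_hTranslate (c : (Fin 2 → ZMod 2) → ℂ) :
    IsModularFunction 16 (-8) fun τ => ∑ v, c v * hTranslate v τ where
  holo := by
    rw [UpperHalfPlane.mdifferentiable_iff]
    exact DifferentiableOn.fun_sum fun v _ =>
      (UpperHalfPlane.mdifferentiable_iff.1 (mdifferentiable_hTranslate v)).const_mul (c v)
  invariant γ hγ := by
    have hγ2 : γ.mat ∈ CongruenceSubgroup.Gamma 2 := by
      obtain ⟨h00, h01, h10, h11⟩ := CongruenceSubgroup.Gamma_mem.1 hγ
      have hred : ∀ a b : ℤ, (a : ZMod 16) = b → (a : ZMod 2) = b := by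
        intro a b hab
        have := congrArg (ZMod.castHom (by norm_num : 2 ∣ 16) (ZMod 2)) hab
        simpa using this
      rw [CongruenceSubgroup.Gamma_mem]
      exact ⟨by simpa using hred _ 1 (by simpa using h00),
        by simpa using hred _ 0 (by simpa using h01), by simpa using hred _ 0 (by simpa using h10),
        by simpa using hred _ 1 (by simpa using h11)⟩
    rw [mpSlash_eq_slash, slash_sum_hTranslate]
    simp_rw [rowMul_of_mem_Gamma hγ2]
  mero_cusps γ := by
    refine ⟨1, ?_⟩
    simp only [mpSlash_eq_slash, slash_sum_hTranslate, pow_one, Finset.mul_sum]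
    have hterm : ∀ v, IsBoundedAtImInfty fun τ : ℍ =>
        Function.Periodic.qParam 1 τ * (c v * hTranslate (rowMul v γ.mat) τ) := by
      intro v
      simp only [mul_left_comm _ (c v)]
      exact (isBoundedAtImInfty_qParam_mul_hTranslate _).const_mul_left (c v)
    exact Asymptotics.IsBigO.fun_sum fun v _ => hterm v

lemma isModularFunction_add_h (a b d : ℂ) :
    IsModularFunction 16 (-8) fun τ : ℍ => a * h τ + b * h (τ / 2) + d * h ((τ + 1) / 2) := by
  have huniv : (Finset.univ : Finset (Fin 2 → ZMod 2)) = {0, ![0, 1], ![1, 0], ![1, 1]} := by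
    decide
  convert isModularFunction_sum_hTranslate fun v =>
    if v = ![0, 1] then 16 * a else if v = ![1, 0] then b else d using 2 with τ
  rw [huniv, Finset.sum_insert (by decide), Finset.sum_insert (by decide),
    Finset.sum_insert (by decide), Finset.sum_singleton, hTranslate_zero, hTranslate_zero_one,
    hTranslate_one_zero, hTranslate_one_one, if_pos rfl, if_neg (by decide), if_neg (by decide),
    if_neg (by decide), if_pos rfl, if_neg (by decide), if_neg (by decide), Pi.zero_apply]
  ring

end FakeBabyMonster

theorem lemma2p7 :
    -- the identities between functions on the upper half plane
    (∀ τ : ℍ,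
      (FakeBabyMonster.g₀ τ + FakeBabyMonster.h τ =
        FakeBabyMonster.weightEnumerator (FakeBabyMonster.hamming16 : Set (Fin 16 → ZMod 2))
          (FakeBabyMonster.c₀ τ) (FakeBabyMonster.c₁ τ)) ∧
      (FakeBabyMonster.g₀ τ =
        FakeBabyMonster.weightEnumerator (FakeBabyMonster.hammingCoset FakeBabyMonster.vec11)
          (FakeBabyMonster.c₀ τ) (FakeBabyMonster.c₁ τ)) ∧
      (FakeBabyMonster.g₀ τ =
        FakeBabyMonster.weightEnumerator FakeBabyMonster.oddWords8
          (FakeBabyMonster.c₀ τ) (FakeBabyMonster.c₁ τ) * FakeBabyMonster.c₂ τ ^ 8) ∧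
      (FakeBabyMonster.g₀ τ = 2 ^ 3 * FakeBabyMonster.c₂ τ ^ 16) ∧
      (FakeBabyMonster.g₁ τ =
        FakeBabyMonster.weightEnumerator (FakeBabyMonster.hammingCoset FakeBabyMonster.vec1)
          (FakeBabyMonster.c₀ τ) (FakeBabyMonster.c₁ τ)) ∧
      (FakeBabyMonster.g₁ τ =
        FakeBabyMonster.weightEnumerator FakeBabyMonster.evenWords8
          (FakeBabyMonster.c₀ τ) (FakeBabyMonster.c₁ τ) * FakeBabyMonster.c₂ τ ^ 8)) ∧
    -- all of these are modular functions of weight `-8` for `Γ̃(16)`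
    FakeBabyMonster.IsModularFunction 16 (-8)
      (fun τ : ℍ => FakeBabyMonster.g₀ τ + FakeBabyMonster.h τ) ∧
    FakeBabyMonster.IsModularFunction 16 (-8) (fun τ : ℍ => FakeBabyMonster.g₀ τ) ∧
    FakeBabyMonster.IsModularFunction 16 (-8) (fun τ : ℍ => FakeBabyMonster.g₁ τ) := by
  open FakeBabyMonster in
  refine ⟨fun τ => ?_, ?_, ?_, ?_⟩
  · have hτ := τ.im_pos
    have hJ := c₀_add_c₁_pow_sub hτ
    have hg₀ : g₀ τ = 8 * c₂ τ ^ 16 := by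
      rw [g₀_eq hτ, hJ]
      ring
    have hg₀' := g₀_eq hτ
    have hg₁ := g₁_eq hτ
    have hh := h_eq hτ
    rw [weightEnumerator_hamming16, weightEnumerator_hammingCoset_vec11,
      weightEnumerator_hammingCoset_vec1, weightEnumerator_oddWords8, weightEnumerator_evenWords8]
    generalize c₀ τ + c₁ τ = a at *
    generalize c₀ τ - c₁ τ = b at *
    refine ⟨?_, ?_, hg₀', ?_, ?_, hg₁⟩
    · rw [hg₀, hh]
      linear_combination (-(a ^ 8 - b ^ 8 + 16 * c₂ τ ^ 8) / 32) * hJ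
    · rw [hg₀, hJ]
      ring
    · rw [hg₀]
      ring
    · rw [hg₁]
      linear_combination (-(a ^ 8 + b ^ 8) / 32) * hJ
  · convert isModularFunction_add_h 1 (1 / 2) (1 / 2) using 2 with τ
    rw [g₀]
    ring
  · convert isModularFunction_add_h 0 (1 / 2) (1 / 2) using 2 with τ
    rw [g₀]
    ring
  · convert isModularFunction_add_h 0 (1 / 2) (-1 / 2) using 2 with τ
    rw [g₁]
    ring
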